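/- **Random graphs.** Let $(\chi,\mu)$ be a probability space, $W:\chi\times\chi\to[0,1]$ a symmetric measurable graphon whose degree $d_W(x)=\int W(x,y)\,d\mu(y)$ satisfies $d_W(x)\ge d_{\min}>0$ for all $x$, and $g\in L^\infty(\chi;\mathbb R^{d_0})$ a measurable signal, given by $g(x)=g_{c(x)}(x)$ for a family of generative functions $(g_k)_k$ and a labelling $c$ of $\chi$ (so entities may have their signals generated by the same or by distinct functions). A random graph of $n$ entities is obtained by drawing latent variables $X_1,\dots,X_n$ i.i.d. from $\mu$, joining distinct $i,j$ independently with probability $W(X_i,X_j)$, and giving entity $i$ the signal $g(X_i)$. The training graph $\mathcal G^{\rm train}_s$ and the test graph $\mathcal G^{\rm test}_s$ are independent random graphs of this model, whose (random) numbers of entities are such that $M=\max\operatorname{supp}|\mathcal V^{\rm train}_s|$ exists and every size in the support of $|\mathcal V^{\rm test}_s|$ exceeds $M$. **Predictor.** A predictor with $L$ layers and hidden sizes $|h^{(\ell)}|$ computes, from $h^{(0)}_i=g(X_i)$, $$h^{(\ell)}_i=\Psi^{(\ell)}\Big(h_i^{(\ell-1)},\ \tfrac1{|N(i)|}\sum_{j\in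 N(i)}\Phi^{(\ell)}(h_i^{(\ell-1)},h_j^{(\ell-1)})\Big),\qquad \ell=1,\dots,L,$$ where $\Phi^{(\ell)}$ and $\Psi^{(\ell)}$ both take values in $\mathbb R^{|h^{(\ell)}|}$ (an empty average is $0$), and scores the fact $(u,q,v)$ by $\hat y_{uv}=\mathrm{Readout}_q(h^{(L)}_u,h^{(L)}_v)\in\mathbb R$. Its continuous counterpart $f^{(L)}:\chi\to\mathbb R^{|h^{(L)}|}$ is defined by $f^{(0)}=g$ and the same recursion with the neighbourhood average replaced by $\int \frac{W(x,y)}{d_W(x)}\Phi^{(\ell)}(f^{(\ell-1)}(x),f^{(\ell-1)}(y))\,d\mu(y)$. The predictor is a function of the training graph. For every training graph with at most $M$ entities, the Lipschitz constants of $\Phi^{(\ell)},\Psi^{(\ell)}$ and the norms $\|\Phi^{(\ell)}(0,0)\|,\|\Psi^{(\ell)}(0,0)\|$ are at most given constants (which may depend on $M$), and the readouts are Lipschitz with constant $L(M)$. All vector norms are maximum norms, also on pairs; $\|g\|_\infty$ is the essential supremum norm. **Theorem.** There are constants $C_1,C_2\ge 0$, depending only on $L$ and on the given bounds for the layers, such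 that the following holds for all such models and predictors. Let $p\in(0,1)$, and suppose that every $n$ in the support of $|\mathcal V_s^{\rm test}|$ satisfies $$\frac{\sqrt n}{\sqrt{\log(2n/p)}}\ \ge\ \frac{4\sqrt2}{d_{\min}} .$$ Then, for almost every training graph, with probability at least $1-\sum_{\ell=1}^{L}2(|h^{(\ell)}|+1)p$ over the test graph (with $n=|\mathcal V_s^{\rm test}|$): 1. $\displaystyle \max_{i}\big\|h_i^{(L)}-f^{(L)}(X_i)\big\|_\infty\le \frac{C_1+C_2\|g\|_\infty}{d_{\min}}\sqrt{\frac{\log(2n/p)}{n}}$; 2. for all query relations $q$, all entities $u,v,v'$ of the test graph and all thresholds $\tau\in[0,1]$ with $\hat y_{uv}\ne\tau$ and $$\frac{\sqrt n}{\sqrt{\log(2n/p)}}\ \ge\ \frac{2\,(C_1+C_2\|g\|_\infty)/d_{\min}}{|\hat y_{uv}-\tau|/L(M)},$$ if $v$ and $v'$ are isomorphic, then the thresholded predictions agree: $\hat y_{uv}$ and $\hat y_{uv'}$ are both $>\tau$ or both $<\tau$. This holds whether the signals of $v,v'$ are generated by the same or by distinct functions $g_k$. Here $v,v'$ count as isomorphic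 if a $\mu$-preserving automorphism of $\chi$ that preserves $W$ and $g$ maps $X_v$ to $X_{v'}$, or an automorphism of the test graph that preserves the signals maps $v$ to $v'$, or just $f^{(L)}(X_v)=f^{(L)}(X_{v'})$. (If $L(M)=0$, the condition on the right-hand side in 2 is read as $\ge 0$.) -/

import Mathlib

open MeasureTheory
open scoped NNReal ENNReal

noncomputable section

namespace GraphExtrapolation

/-! ## The random graph model -/

/-- A graphon random graph model with node signals over a latent space `χ`.

* `μ` is the law of the latent variable of an entity and `W` is the graphon.
* `gen k` (for `k : K`) are the generative functions of the graph signal. An entity with latent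
  variable `x` has its signal generated by `gen (label x)`, so two entities may have their signals
  generated by the same or by distinct functions. -/
structure GraphModel (χ : Type*) [MeasurableSpace χ] (K : Type*) (F : ℕ) where
  μ : Measure χ
  isProb : IsProbabilityMeasure μ
  W : χ → χ → ℝ
  measurable_W : Measurable (Function.uncurry W)
  W_nonneg : ∀ x y, 0 ≤ W x y
  W_le_one : ∀ x y, W x y ≤ 1
  W_symm : ∀ x y, W x y = W y x
  label : χ → K
  gen : K → χ → (Fin F → ℝ)
  measurable_gen : Measurable fun x => gen (label x) x
  memLp_gen : MemLp (fun x => gen (label x) x) ∞ μ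

/-- The randomness behind a graph on `n` entities: the latent variables of the entities, and a
uniform variable for every unordered pair of entities (loops are never used). -/
abbrev Sample (χ : Type*) (n : ℕ) : Type _ :=
  (Fin n → χ) × (Sym2 (Fin n) → unitInterval)

/-- What can be seen of a random graph: the number of entities, the edges, the signals. -/
abbrev SignalGraph (F : ℕ) : Type :=
  Σ n : ℕ, SimpleGraph (Fin n) × (Fin n → (Fin F → ℝ))

namespace GraphModel

variable {χ : Type*} [MeasurableSpace χ] {K : Type*} {F : ℕ}

/-- The signal `g` at a latent point. -/
def signal (P : GraphModel χ K F) (x : χ) : Fin F → ℝ := P.gen (P.label x) x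

/-- The essential supremum norm `‖g‖_∞`. -/
def signalNorm (P : GraphModel χ K F) : ℝ := (eLpNorm P.signal ∞ P.μ).toReal

/-- The graphon degree `d_W(x) = ∫ W(x, y) dμ(y)`. -/
def degree (P : GraphModel χ K F) (x : χ) : ℝ := ∫ y, P.W x y ∂P.μ

/-- The law of the randomness at a fixed number `n` of entities: everything is independent. -/
def fixedLaw (P : GraphModel χ K F) (n : ℕ) : Measure (Sample χ n) :=
  (Measure.pi fun _ : Fin n => P.μ).prod
    (Measure.pi fun _ : Sym2 (Fin n) => (volume : Measure unitInterval))

/-- The law of a sample whose number of entities has the distribution `N`. -/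
def law (P : GraphModel χ K F) (N : PMF ℕ) : Measure (Σ n : ℕ, Sample χ n) :=
  Measure.sum fun n => N n • (P.fixedLaw n).map (Sigma.mk n)

/-- The graph of a sample: distinct entities `i`, `j` are joined with probability `W(X_i, X_j)`. -/
def graph (P : GraphModel χ K F) {n : ℕ} (S : Sample χ n) : SimpleGraph (Fin n) where
  Adj i j := i ≠ j ∧ (S.2 s(i, j) : ℝ) < P.W (S.1 i) (S.1 j)
  symm := ⟨by
    rintro i j ⟨hne, h⟩
    refine ⟨hne.symm, ?_⟩
    rw [Sym2.eq_swap, P.W_symm]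
    exact h⟩
  loopless := ⟨fun _ h => h.1 rfl⟩

/-- The observed graph with signals of a sample. -/
def observe (P : GraphModel χ K F) (S : Σ n : ℕ, Sample χ n) : SignalGraph F :=
  ⟨S.1, P.graph S.2, fun i => P.signal (S.2.1 i)⟩

/-- Two latent points are isomorphic when a symmetry of the random graph model (an automorphism
of the latent probability space that preserves the graphon and the signal) maps one to the
other. The signals at the two points may be generated by distinct functions. -/
def Isomorphic (P : GraphModel χ K F) (x y : χ) : Prop :=
  ∃ T : χ ≃ᵐ χ, MeasurePreserving T P.μ P.μ ∧ (∀ a b, P.W (T a) (T b) = P.W a b) ∧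
    (∀ a, P.signal (T a) = P.signal a) ∧ T x = y

end GraphModel

/-- Two entities of a graph with signals are isomorphic when an automorphism of the graph that
preserves the signals maps one to the other. -/
def IsomorphicIn {F n : ℕ} (G : SimpleGraph (Fin n)) (s : Fin n → (Fin F → ℝ))
    (i j : Fin n) : Prop :=
  ∃ σ : G ≃g G, (∀ a, s (σ a) = s a) ∧ σ i = j

/-! ## The predictor -/

/-- A message passing predictor with hidden sizes `d 0, d 1, d 2, …` (`d 0` is the size of the
input signal) for query relations in `Q`. Only the first `L` steps are used by a predictor of
depth `L`. All vector norms are maximum norms. -/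
structure Predictor (Q : Type*) (d : ℕ → ℕ) where
  /-- the message functions `Φ^{(ℓ+1)}`, applied to (receiving entity, sending entity) -/
  msg : ∀ ℓ, (Fin (d ℓ) → ℝ) × (Fin (d ℓ) → ℝ) → (Fin (d (ℓ + 1)) → ℝ)
  /-- the update functions `Ψ^{(ℓ+1)}`, applied to (representation, aggregated message) -/
  upd : ∀ ℓ, (Fin (d ℓ) → ℝ) × (Fin (d (ℓ + 1)) → ℝ) → (Fin (d (ℓ + 1)) → ℝ)
  /-- the readout of the predictor of depth `L`, applied to the final representations of the
  query entity and of the answer entity -/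
  readout : ∀ L, Q → (Fin (d L) → ℝ) × (Fin (d L) → ℝ) → ℝ

/-- Bounds for the Lipschitz constants and for the values at the origin of the message and
update functions. -/
structure LayerBounds where
  msgLip : ℕ → ℝ≥0
  updLip : ℕ → ℝ≥0
  msgBias : ℕ → ℝ≥0
  updBias : ℕ → ℝ≥0

namespace Predictor

variable {Q : Type*} {d : ℕ → ℕ}

/-- The first `L` layers obey the bounds `B`. -/
def HasLayerBounds (θ : Predictor Q d) (L : ℕ) (B : LayerBounds) : Prop :=
  ∀ ℓ < L, LipschitzWith (B.msgLip ℓ) (θ.msg ℓ) ∧ LipschitzWith (B.updLip ℓ) (θ.upd ℓ) ∧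
    ‖θ.msg ℓ 0‖ ≤ B.msgBias ℓ ∧ ‖θ.upd ℓ 0‖ ≤ B.updBias ℓ

open Classical in
/-- The average of `f` over the neighbours of `i` (zero when there are none). -/
def neighborMean {n m : ℕ} (G : SimpleGraph (Fin n)) (f : Fin n → (Fin m → ℝ)) (i : Fin n) :
    Fin m → ℝ :=
  ((Finset.univ.filter (G.Adj i)).card : ℝ)⁻¹ • ∑ j ∈ Finset.univ.filter (G.Adj i), f j

/-- The representations after `ℓ` steps of message passing on a graph with signals `s`. -/
def rep (θ : Predictor Q d) {n : ℕ} (G : SimpleGraph (Fin n)) (s : Fin n → (Fin (d 0) → ℝ)) :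
    ∀ ℓ, Fin n → (Fin (d ℓ) → ℝ)
  | 0 => s
  | ℓ + 1 => fun i =>
      θ.upd ℓ (rep θ G s ℓ i,
        neighborMean G (fun j => θ.msg ℓ (rep θ G s ℓ i, rep θ G s ℓ j)) i)

/-- The continuous counterpart: the average over the neighbours is replaced by the integral
against `W(x, y) / d_W(x) dμ(y)`. -/
def contRep {χ : Type*} [MeasurableSpace χ] {K : Type*} (θ : Predictor Q d)
    (P : GraphModel χ K (d 0)) : ∀ ℓ, χ → (Fin (d ℓ) → ℝ)
  | 0 => P.signal
  | ℓ + 1 => fun x =>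
      θ.upd ℓ (contRep θ P ℓ x,
        ∫ y, (P.W x y / P.degree x) • θ.msg ℓ (contRep θ P ℓ x, contRep θ P ℓ y) ∂P.μ)

/-- The score of the fact `(u, q, v)` given by the predictor of depth `L`. -/
def score (θ : Predictor Q d) (L : ℕ) (G : SignalGraph (d 0)) (q : Q) (u v : Fin G.1) : ℝ :=
  θ.readout L q (θ.rep G.2.1 G.2.2 L u, θ.rep G.2.1 G.2.2 L v)

end Predictor

end GraphExtrapolation

end

/-! Fix the training graph, hence the predictor, and a test size `n = m + 1`. Concentration is
applied to the messages between the continuous representations, not the computed ones: these are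
deterministic functions `φ` of two latent points. Given `X_i`, the sum of `φ (X_i, X_j)` over the
neighbours `j` of `i` is therefore a sum of `m` i.i.d. bounded variables with mean `∫ W(X_i, y)
φ(X_i, y) dμ(y)`, and Hoeffding's inequality applies (`fixedLaw_edge_sum_deviation_le`). Taking `φ =
1` controls the degree. The quotient of the two sums is the neighbourhood mean of the continuous
messages, so it is close to the normalized graphon integral (`abs_inv_mul_sub_div_le`).

A union bound over entities, message coordinates and layers gives one event on which all these
estimates hold. There the computed representations follow the continuous ones by induction on the
layer, using only Lipschitz bounds (`norm_rep_sub_contRep_le`). The accumulated constant is affine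
in `‖g‖_∞`, with coefficients depending only on the layer bounds and the depth.

Isomorphic latent points have equal continuous representations, so the computed ones at `v` and `v'`
differ by less than twice the error, and the Lipschitz readout cannot carry the score across `τ`. An
automorphism of the observed graph makes them exactly equal (`score_same_side`). -/

namespace GraphExtrapolation

open ProbabilityTheory

/-! ### Hoeffding's inequality for i.i.d. almost surely bounded variables. -/

section Hoeffding

variable {α : Type*} [MeasurableSpace α]

/-- Hoeffding's lemma on `[-K, K]`: the variance proxy is the square of half the length. -/
theorem hasSubgaussianMGF_of_ae_abs_le (ν : Measure α) [IsProbabilityMeasure ν] {f : α → ℝ}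
    (hf : Measurable f) {K : ℝ} (hK : 0 ≤ K) (hfK : ∀ᵐ a ∂ν, |f a| ≤ K) :
    HasSubgaussianMGF (fun a => f a - ∫ b, f b ∂ν) ((K ^ 2).toNNReal) ν := by
  have h := hasSubgaussianMGF_of_mem_Icc (μ := ν) (X := f) (a := -K) (b := K) hf.aemeasurable
    (hfK.mono fun a ha => abs_le.1 ha)
  convert h using 1
  apply NNReal.coe_injective
  rw [Real.coe_toNNReal _ (sq_nonneg K)]
  push_cast
  rw [show K - -K = 2 * K by ring, Real.norm_of_nonneg (by positivity)]
  ring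

theorem measureReal_pi_abs_sum_sub_ge_le (ν : Measure α) [IsProbabilityMeasure ν] (m : ℕ)
    {f : α → ℝ} (hf : Measurable f) {K : ℝ} (hK : 0 ≤ K) (hfK : ∀ᵐ a ∂ν, |f a| ≤ K)
    {t : ℝ} (ht : 0 ≤ t) :
    (Measure.pi fun _ : Fin m => ν).real {z | t ≤ |∑ j, (f (z j) - ∫ a, f a ∂ν)|}
      ≤ 2 * Real.exp (-t ^ 2 / (2 * (m * K ^ 2))) := by
  set c := ∫ a, f a ∂ν with hc
  have hsub := hasSubgaussianMGF_of_ae_abs_le ν hf hK hfK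
  have hgen : ∀ X : α → ℝ, Measurable X → HasSubgaussianMGF X ((K ^ 2).toNNReal) ν →
      (Measure.pi fun _ : Fin m => ν).real {z | t ≤ ∑ j, X (z j)}
        ≤ Real.exp (-t ^ 2 / (2 * (m * K ^ 2))) := by
    intro X hXm hX
    have hind : iIndepFun (fun (j : Fin m) (z : Fin m → α) => X (z j))
        (Measure.pi fun _ : Fin m => ν) :=
      iIndepFun_pi (X := fun _ => X) fun _ => hXm.aemeasurable
    have hs : ∀ j ∈ (Finset.univ : Finset (Fin m)),
        HasSubgaussianMGF (fun z : Fin m → α => X (z j)) ((K ^ 2).toNNReal)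
          (Measure.pi fun _ : Fin m => ν) := by
      intro j _
      have he := measurePreserving_eval (fun _ : Fin m => ν) j
      refine HasSubgaussianMGF.of_map (X := X) (Y := fun z : Fin m → α => z j)
        he.measurable.aemeasurable ?_
      have := he.map_eq
      rw [show (fun z : Fin m → α => z j) = Function.eval j from rfl, this]
      exact hX
    have := HasSubgaussianMGF.measure_sum_ge_le_of_iIndepFun hind hs ht
    simpa [Real.coe_toNNReal _ (sq_nonneg K)] using this
  have h1 := hgen (fun a => f a - c) (hf.sub_const c) hsub
  have h2 := hgen (fun a => -(f a - c)) (hf.sub_const c).neg hsub.neg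
  have hsubset : {z : Fin m → α | t ≤ |∑ j, (f (z j) - c)|} ⊆
      {z | t ≤ ∑ j, (f (z j) - c)} ∪ {z | t ≤ ∑ j, -(f (z j) - c)} := by
    intro z hz
    rcases le_abs.1 (show t ≤ |∑ j, (f (z j) - c)| from hz) with h | h
    · exact Or.inl h
    · right
      simpa only [Set.mem_ofPred_eq, Finset.sum_neg_distrib] using h
  calc _ ≤ _ := measureReal_mono hsubset
    _ ≤ _ := measureReal_union_le _ _
    _ ≤ _ := by linarith

end Hoeffding

/-! ### Concentration of sums over the neighbours of one entity. -/

namespace GraphModel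

variable {χ : Type*} [MeasurableSpace χ] {K : Type*} {F : ℕ}

instance isProbabilityMeasure_μ (P : GraphModel χ K F) : IsProbabilityMeasure P.μ := P.isProb

instance isProbabilityMeasure_fixedLaw (P : GraphModel χ K F) (n : ℕ) :
    IsProbabilityMeasure (P.fixedLaw n) := by
  unfold fixedLaw; infer_instance

/-- The part of a sample that determines the neighbourhood of the entity `i`. -/
def starData {m : ℕ} (i : Fin (m + 1)) (S : Sample χ (m + 1)) :
    χ × (Fin m → χ × unitInterval) :=
  (S.1 i, fun j => (S.1 (i.succAbove j), S.2 s(i, i.succAbove j)))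

theorem measurePreserving_pi_precomp {ι κ α : Type*} [Fintype ι] [Fintype κ] [MeasurableSpace α]
    (ν : Measure α) [IsProbabilityMeasure ν] {e : κ → ι} (he : Function.Injective e) :
    MeasurePreserving (fun (z : ι → α) k => z (e k)) (Measure.pi fun _ => ν)
      (Measure.pi fun _ => ν) := by
  refine ⟨by fun_prop, ?_⟩
  have h : iIndepFun (fun (i : ι) (z : ι → α) => z i) (Measure.pi fun _ : ι => ν) :=
    iIndepFun_pi (X := fun _ => id) fun _ => aemeasurable_id
  rw [(iIndepFun_iff_map_fun_eq_pi_map fun k =>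
    (measurable_pi_apply _).aemeasurable).1 (h.precomp he)]
  congr 1
  funext k
  exact (measurePreserving_eval (fun _ : ι => ν) (e k)).map_eq

/-- The pairs `s(i, j)` with `j ≠ i` are distinct coordinates, so their uniform variables are
independent of each other and of the latent variables. Each other entity thus contributes one
independent pair. -/
theorem measurePreserving_starData (P : GraphModel χ K F) {m : ℕ} (i : Fin (m + 1)) :
    MeasurePreserving (starData i) (P.fixedLaw (m + 1))
      (P.μ.prod (Measure.pi fun _ : Fin m => P.μ.prod (volume : Measure unitInterval))) := by
  have he : Function.Injective fun j : Fin m => s(i, i.succAbove j) := by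
    intro a b hab
    exact Fin.succAbove_right_injective (Sym2.congr_right.1 hab)
  have h1 := measurePreserving_piFinSuccAbove (fun _ : Fin (m + 1) => P.μ) i
  have h2 := measurePreserving_pi_precomp (volume : Measure unitInterval) he
  have h3 := (h1.prod h2)
  have h4 := measurePreserving_prodAssoc P.μ (Measure.pi fun _ : Fin m => P.μ)
    (Measure.pi fun _ : Fin m => (volume : Measure unitInterval))
  have h5 := (measurePreserving_arrowProdEquivProdArrow χ unitInterval (Fin m)
    (fun _ => P.μ) (fun _ => volume)).symm
  have h6 := (MeasurePreserving.id P.μ).prod h5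
  exact h6.comp (h4.comp h3)

theorem integral_edge (P : GraphModel χ K F) (x : χ) {φ : χ → ℝ} (hφ : Measurable φ) {b : ℝ}
    (hb : ∀ᵐ y ∂P.μ, |φ y| ≤ b) :
    ∫ z : χ × unitInterval, (if (z.2 : ℝ) < P.W x z.1 then φ z.1 else 0)
        ∂(P.μ.prod (volume : Measure unitInterval))
      = ∫ y, P.W x y * φ y ∂P.μ := by
  have hW : Measurable fun y => P.W x y := P.measurable_W.comp measurable_prodMk_left
  have hm : Measurable fun z : χ × unitInterval =>
      if (z.2 : ℝ) < P.W x z.1 then φ z.1 else 0 :=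
    Measurable.ite (measurableSet_lt (by fun_prop) (by fun_prop)) (by fun_prop) measurable_const
  have hbz : ∀ᵐ z ∂(P.μ.prod (volume : Measure unitInterval)), |φ z.1| ≤ b :=
    Measure.quasiMeasurePreserving_fst.ae hb
  rw [integral_prod]
  · refine integral_congr_ae (Filter.Eventually.of_forall fun y => ?_)
    simp only
    have : (fun u : unitInterval => if (u : ℝ) < P.W x y then φ y else 0)
        = Set.indicator (Set.Iio (⟨P.W x y, P.W_nonneg x y, P.W_le_one x y⟩ : unitInterval))
          fun _ => φ y := by
      funext u
      simp only [Set.indicator, Set.mem_Iio, ← Subtype.coe_lt_coe]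
    rw [this, integral_indicator_const _ measurableSet_Iio]
    simp [measureReal_def, P.W_nonneg x y]
  · refine Integrable.of_bound hm.aestronglyMeasurable b (hbz.mono fun z hz => ?_)
    split_ifs
    · exact hz
    · simpa using (abs_nonneg _).trans hz

/-- The sum of `φ (X_i, X_j)` over the neighbours `j` of `i` deviates from `n - 1` times its mean
with exponentially small probability. -/
theorem fixedLaw_edge_sum_deviation_le (P : GraphModel χ K F) {m : ℕ} (i : Fin (m + 1))
    {φ : χ × χ → ℝ} (hφ : Measurable φ) {b : ℝ} (hb0 : 0 ≤ b)
    (hb : ∀ᵐ x ∂P.μ, ∀ᵐ y ∂P.μ, |φ (x, y)| ≤ b) {t : ℝ} (ht : 0 ≤ t) :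
    P.fixedLaw (m + 1) {S | t ≤ |∑ j : Fin m,
        ((if (S.2 s(i, i.succAbove j) : ℝ) < P.W (S.1 i) (S.1 (i.succAbove j))
          then φ (S.1 i, S.1 (i.succAbove j)) else 0)
          - ∫ y, P.W (S.1 i) y * φ (S.1 i, y) ∂P.μ)|}
      ≤ ENNReal.ofReal (2 * Real.exp (-t ^ 2 / (2 * (m * b ^ 2)))) := by
  have hW' := P.measurable_W
  have hW : Measurable fun q : χ × χ => P.W q.1 q.2 := hW'
  have hmean : Measurable fun x => ∫ y, P.W x y * φ (x, y) ∂P.μ :=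
    ((hW.mul hφ).stronglyMeasurable.integral_prod_right'
      (f := fun q : χ × χ => P.W q.1 q.2 * φ q)).measurable
  set E : Set (χ × (Fin m → χ × unitInterval)) :=
    {w | t ≤ |∑ j : Fin m, ((if ((w.2 j).2 : ℝ) < P.W w.1 (w.2 j).1 then φ (w.1, (w.2 j).1) else 0)
      - ∫ y, P.W w.1 y * φ (w.1, y) ∂P.μ)|} with hE
  have hEm : MeasurableSet E := by
    refine measurableSet_le measurable_const (Measurable.abs ?_)
    refine Finset.measurable_sum _ fun j _ => Measurable.sub ?_ (hmean.comp measurable_fst)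
    have hX : Measurable fun w : χ × (Fin m → χ × unitInterval) => (w.1, (w.2 j).1) := by fun_prop
    exact Measurable.ite (measurableSet_lt (by fun_prop) (hW.comp hX)) (hφ.comp hX)
      measurable_const
  change P.fixedLaw (m + 1) (starData i ⁻¹' E) ≤ _
  -- Fubini freezes `X_i = x`; the remaining pairs are i.i.d., and the Hoeffding bound is uniform in
  -- almost every `x`.
  rw [(P.measurePreserving_starData i).measure_preimage hEm.nullMeasurableSet,
    Measure.prod_apply hEm]
  calc _ ≤ ∫⁻ _, ENNReal.ofReal (2 * Real.exp (-t ^ 2 / (2 * (m * b ^ 2)))) ∂P.μ := by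
        refine lintegral_mono_ae (hb.mono fun x hx => ?_)
        have hφx : Measurable fun y => φ (x, y) := hφ.comp measurable_prodMk_left
        have hWx : Measurable fun y => P.W x y := hW.comp measurable_prodMk_left
        have hf : Measurable fun z : χ × unitInterval =>
            if (z.2 : ℝ) < P.W x z.1 then φ (x, z.1) else 0 :=
          Measurable.ite (measurableSet_lt (by fun_prop) (by fun_prop)) (by fun_prop)
            measurable_const
        have hfb : ∀ᵐ z ∂(P.μ.prod (volume : Measure unitInterval)),
            |if (z.2 : ℝ) < P.W x z.1 then φ (x, z.1) else 0| ≤ b := by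
          refine (Measure.quasiMeasurePreserving_fst.ae hx).mono fun z hz => ?_
          split_ifs
          · exact hz
          · simpa using hb0
        have h := measureReal_pi_abs_sum_sub_ge_le _ m hf hb0 hfb ht
        rw [P.integral_edge x hφx hx] at h
        rw [← ofReal_measureReal]
        exact ENNReal.ofReal_le_ofReal h
    _ = _ := by simp

end GraphModel

/-! ### Recursive constants, affine in the signal norm. -/

namespace LayerBounds

/-- A bound for the messages of the layer `ℓ` between representations of norm at most `b`. -/
noncomputable def msgBound (B : LayerBounds) (ℓ : ℕ) (b : ℝ) : ℝ := B.msgBias ℓ + B.msgLip ℓ * b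

/-- A bound for the continuous representations when the signal has norm at most `g`. -/
noncomputable def repBound (B : LayerBounds) (g : ℝ) : ℕ → ℝ
  | 0 => g
  | ℓ + 1 => B.updBias ℓ + B.updLip ℓ * (repBound B g ℓ + B.msgBound ℓ (repBound B g ℓ))

/-- The accumulated deviation of the discrete from the continuous representations, in units of
`√(log (2 n / p) / n) / dmin`. -/
noncomputable def errBound (B : LayerBounds) (g : ℝ) : ℕ → ℝ
  | 0 => 0
  | ℓ + 1 => B.updLip ℓ *
      ((1 + B.msgLip ℓ) * errBound B g ℓ + 8 * (B.msgBound ℓ (B.repBound g ℓ) + 1))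

theorem exists_repBound_eq (B : LayerBounds) (ℓ : ℕ) :
    ∃ a b : ℝ, 0 ≤ a ∧ 0 ≤ b ∧ ∀ g, B.repBound g ℓ = a + b * g := by
  induction ℓ with
  | zero => exact ⟨0, 1, le_rfl, zero_le_one, fun g => by simp [repBound]⟩
  | succ ℓ ih =>
    obtain ⟨a, b, ha, hb, h⟩ := ih
    refine ⟨B.updBias ℓ + B.updLip ℓ * (a + (B.msgBias ℓ + B.msgLip ℓ * a)),
      B.updLip ℓ * (b + B.msgLip ℓ * b), by positivity, by positivity, fun g => ?_⟩
    rw [repBound, h, msgBound]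
    ring

theorem exists_errBound_eq (B : LayerBounds) (ℓ : ℕ) :
    ∃ a b : ℝ, 0 ≤ a ∧ 0 ≤ b ∧ ∀ g, B.errBound g ℓ = a + b * g := by
  induction ℓ with
  | zero => exact ⟨0, 0, le_rfl, le_rfl, fun g => by simp [errBound]⟩
  | succ ℓ ih =>
    obtain ⟨a, b, ha, hb, h⟩ := ih
    obtain ⟨a', b', ha', hb', h'⟩ := B.exists_repBound_eq ℓ
    refine ⟨B.updLip ℓ * ((1 + B.msgLip ℓ) * a + 8 * (B.msgBias ℓ + B.msgLip ℓ * a' + 1)),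
      B.updLip ℓ * ((1 + B.msgLip ℓ) * b + 8 * (B.msgLip ℓ * b')), by positivity, by positivity,
      fun g => ?_⟩
    rw [errBound, h, h', msgBound]
    ring

theorem repBound_nonneg (B : LayerBounds) {g : ℝ} (hg : 0 ≤ g) (ℓ : ℕ) : 0 ≤ B.repBound g ℓ := by
  obtain ⟨a, b, ha, hb, h⟩ := B.exists_repBound_eq ℓ
  rw [h]; positivity

theorem msgBound_nonneg (B : LayerBounds) (ℓ : ℕ) {b : ℝ} (hb : 0 ≤ b) : 0 ≤ B.msgBound ℓ b := by
  unfold msgBound; positivity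

end LayerBounds

theorem norm_le_of_lipschitzWith {E E' : Type*} [SeminormedAddCommGroup E]
    [SeminormedAddCommGroup E'] {f : E → E'} {K : ℝ≥0} (hf : LipschitzWith K f) {c : ℝ}
    (hc : ‖f 0‖ ≤ c) {x : E} {b : ℝ} (hx : ‖x‖ ≤ b) : ‖f x‖ ≤ c + K * b := by
  have h := hf.norm_sub_le x 0
  rw [sub_zero] at h
  calc ‖f x‖ ≤ ‖f 0‖ + ‖f x - f 0‖ := norm_le_norm_add_norm_sub' _ _
    _ ≤ c + K * b := by gcongr; exact h.trans (by gcongr)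

/-! ### The normalized graphon operator. -/

namespace GraphModel

variable {χ : Type*} [MeasurableSpace χ] {K : Type*} {F : ℕ}

theorem measurable_uncurry_W (P : GraphModel χ K F) : Measurable fun q : χ × χ => P.W q.1 q.2 :=
  P.measurable_W

theorem measurable_W_right (P : GraphModel χ K F) (x : χ) : Measurable fun y => P.W x y :=
  P.measurable_uncurry_W.comp measurable_prodMk_left

theorem measurable_degree (P : GraphModel χ K F) : Measurable P.degree :=
  (P.measurable_uncurry_W.stronglyMeasurable.integral_prod_right'
    (f := fun q : χ × χ => P.W q.1 q.2)).measurable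

theorem integrable_W (P : GraphModel χ K F) (x : χ) : Integrable (fun y => P.W x y) P.μ := by
  refine Integrable.of_bound (P.measurable_W_right x).aestronglyMeasurable 1
    (Filter.Eventually.of_forall fun y => ?_)
  rw [Real.norm_of_nonneg (P.W_nonneg x y)]
  exact P.W_le_one x y

theorem degree_le_one (P : GraphModel χ K F) (x : χ) : P.degree x ≤ 1 := by
  calc P.degree x ≤ ∫ _, (1 : ℝ) ∂P.μ :=
        integral_mono (P.integrable_W x) (integrable_const _) (P.W_le_one x)
    _ = 1 := by simp

theorem norm_signal_le_signalNorm (P : GraphModel χ K F) :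
    ∀ᵐ x ∂P.μ, ‖P.signal x‖ ≤ P.signalNorm := by
  have h : MemLp P.signal ∞ P.μ := P.memLp_gen
  have hfin : eLpNorm P.signal ∞ P.μ ≠ ∞ := h.2.ne
  unfold signalNorm
  rw [eLpNorm_exponent_top] at hfin ⊢
  filter_upwards [ae_le_eLpNormEssSup (f := P.signal) (μ := P.μ)] with x hx
  rw [← toReal_enorm]
  exact ENNReal.toReal_mono hfin hx

theorem signalNorm_nonneg (P : GraphModel χ K F) : 0 ≤ P.signalNorm := ENNReal.toReal_nonneg

/-- The normalized integral operator of the graphon is bounded by the essential supremum. -/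
theorem norm_integral_W_div_degree_smul_le (P : GraphModel χ K F) {x : χ} (hx : 0 < P.degree x)
    {E : Type*} [NormedAddCommGroup E] [NormedSpace ℝ E] {φ : χ → E} {b : ℝ}
    (hb : ∀ᵐ y ∂P.μ, ‖φ y‖ ≤ b) :
    ‖∫ y, (P.W x y / P.degree x) • φ y ∂P.μ‖ ≤ b := by
  calc _ ≤ ∫ y, P.W x y / P.degree x * b ∂P.μ := by
        refine norm_integral_le_of_norm_le (((P.integrable_W x).div_const _).mul_const _)
          (hb.mono fun y hy => ?_)
        have := P.W_nonneg x y
        rw [norm_smul, Real.norm_of_nonneg (by positivity)]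
        gcongr
    _ = b := by
        rw [integral_mul_const, integral_div, show ∫ y, P.W x y ∂P.μ = P.degree x from rfl,
          div_self hx.ne', one_mul]

theorem integrable_W_div_degree_smul (P : GraphModel χ K F) (x : χ) {m : ℕ}
    {φ : χ → (Fin m → ℝ)} (hφ : Measurable φ) {b : ℝ} (hb : ∀ᵐ y ∂P.μ, ‖φ y‖ ≤ b) :
    Integrable (fun y => (P.W x y / P.degree x) • φ y) P.μ := by
  refine Integrable.mono' (g := fun y => ‖P.W x y / P.degree x‖ * b)
    (((P.integrable_W x).div_const _).norm.mul_const _)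
    (((P.measurable_W_right x).div_const _).smul hφ).aestronglyMeasurable
    (hb.mono fun y hy => ?_)
  rw [norm_smul]
  gcongr

end GraphModel

/-! ### Continuous representations: measurability, bounds and invariance under symmetries. -/

namespace Predictor

variable {χ : Type*} [MeasurableSpace χ] {K Q : Type*} {d : ℕ → ℕ}

theorem measurable_contRep {θ : Predictor Q d} {L : ℕ} {B : LayerBounds}
    (hθ : θ.HasLayerBounds L B) (P : GraphModel χ K (d 0)) {ℓ : ℕ} (hℓ : ℓ ≤ L) :
    Measurable (θ.contRep P ℓ) := by
  induction ℓ with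
  | zero => exact P.measurable_gen
  | succ ℓ ih =>
    have ihm := ih (by omega)
    obtain ⟨hmsg, hupd, -, -⟩ := hθ ℓ (by omega)
    have hm : Measurable fun q : χ × χ => (P.W q.1 q.2 / P.degree q.1) •
        θ.msg ℓ (θ.contRep P ℓ q.1, θ.contRep P ℓ q.2) :=
      (P.measurable_uncurry_W.div (P.measurable_degree.comp measurable_fst)).smul
        (hmsg.continuous.measurable.comp
          ((ihm.comp measurable_fst).prodMk (ihm.comp measurable_snd)))
    exact hupd.continuous.measurable.comp
      (ihm.prodMk hm.stronglyMeasurable.integral_prod_right'.measurable)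

/-- The bound is pointwise wherever the signal obeys its essential bound, so a single null set
serves all layers. -/
theorem norm_contRep_le {θ : Predictor Q d} {L : ℕ} {B : LayerBounds}
    (hθ : θ.HasLayerBounds L B) {P : GraphModel χ K (d 0)} (hdeg : ∀ x, 0 < P.degree x)
    {g : ℝ} (hg : ∀ᵐ x ∂P.μ, ‖P.signal x‖ ≤ g) {ℓ : ℕ} (hℓ : ℓ ≤ L) {x : χ}
    (hx : ‖P.signal x‖ ≤ g) : ‖θ.contRep P ℓ x‖ ≤ B.repBound g ℓ := by
  induction ℓ generalizing x with
  | zero => exact hx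
  | succ ℓ ih =>
    have ih := @ih (by omega)
    obtain ⟨hmsg, hupd, hmb, hub⟩ := hθ ℓ (by omega)
    have hx' := ih hx
    have h0 : 0 ≤ B.repBound g ℓ := (norm_nonneg _).trans hx'
    have hint : ‖∫ y, (P.W x y / P.degree x) •
        θ.msg ℓ (θ.contRep P ℓ x, θ.contRep P ℓ y) ∂P.μ‖ ≤ B.msgBound ℓ (B.repBound g ℓ) :=
      P.norm_integral_W_div_degree_smul_le (hdeg x) (hg.mono fun y hy =>
        norm_le_of_lipschitzWith hmsg hmb (norm_prod_le_iff.2 ⟨hx', ih hy⟩))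
    refine norm_le_of_lipschitzWith hupd hub (norm_prod_le_iff.2 ⟨?_, ?_⟩)
    · exact hx'.trans (le_add_of_nonneg_right (B.msgBound_nonneg ℓ h0))
    · exact hint.trans (le_add_of_nonneg_left h0)

/-- Substituting `y = T z` in the degree and message integrals turns each layer at `T x` into the
same layer at `x`. -/
theorem contRep_comp_automorphism (θ : Predictor Q d) {P : GraphModel χ K (d 0)} {T : χ ≃ᵐ χ}
    (hT : MeasurePreserving T P.μ P.μ) (hW : ∀ a b, P.W (T a) (T b) = P.W a b)
    (hs : ∀ a, P.signal (T a) = P.signal a) (ℓ : ℕ) (x : χ) :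
    θ.contRep P ℓ (T x) = θ.contRep P ℓ x := by
  induction ℓ generalizing x with
  | zero => exact hs x
  | succ ℓ ih =>
    have hd : P.degree (T x) = P.degree x := by
      unfold GraphModel.degree
      rw [← hT.integral_comp' (g := fun y => P.W (T x) y)]
      simp only [hW]
    simp only [contRep]
    rw [← hT.integral_comp' (g := fun y => (P.W (T x) y / P.degree (T x)) •
      θ.msg ℓ (θ.contRep P ℓ (T x), θ.contRep P ℓ y))]
    simp only [hW, hd, ih]

theorem contRep_eq_of_isomorphic (θ : Predictor Q d) {P : GraphModel χ K (d 0)} {x y : χ}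
    (h : P.Isomorphic x y) (ℓ : ℕ) : θ.contRep P ℓ x = θ.contRep P ℓ y := by
  obtain ⟨T, hT, hW, hs, rfl⟩ := h
  exact (θ.contRep_comp_automorphism hT hW hs ℓ x).symm

theorem neighborMean_comp_automorphism {n m : ℕ} {G : SimpleGraph (Fin n)} (σ : G ≃g G)
    (f : Fin n → (Fin m → ℝ)) (i : Fin n) :
    neighborMean G f (σ i) = neighborMean G (fun j => f (σ j)) i := by
  classical
  unfold neighborMean
  have h : Finset.univ.filter (G.Adj (σ i))
      = (Finset.univ.filter (G.Adj i)).map σ.toEquiv.toEmbedding := by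
    ext j
    obtain ⟨k, rfl⟩ := σ.surjective j
    rw [show σ k = σ.toEquiv.toEmbedding k from rfl, Finset.mem_map']
    simp [σ.map_adj_iff]
  have hc : (Finset.univ.filter (G.Adj (σ i))).card = (Finset.univ.filter (G.Adj i)).card := by
    rw [h, Finset.card_map]
  have hs : ∑ j ∈ Finset.univ.filter (G.Adj (σ i)), f j
      = ∑ j ∈ Finset.univ.filter (G.Adj i), f (σ j) := by
    rw [h, Finset.sum_map]; rfl
  convert congrArg₂ (fun (a : ℕ) (b : Fin m → ℝ) => ((a : ℝ)⁻¹) • b) hc hs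

theorem rep_comp_automorphism (θ : Predictor Q d) {n : ℕ} {G : SimpleGraph (Fin n)}
    {s : Fin n → (Fin (d 0) → ℝ)} (σ : G ≃g G) (hs : ∀ a, s (σ a) = s a) (ℓ : ℕ) (i : Fin n) :
    θ.rep G s ℓ (σ i) = θ.rep G s ℓ i := by
  induction ℓ generalizing i with
  | zero => exact hs i
  | succ ℓ ih => simp only [rep, neighborMean_comp_automorphism, ih]

theorem rep_eq_of_isomorphicIn (θ : Predictor Q d) {n : ℕ} {G : SimpleGraph (Fin n)}
    {s : Fin n → (Fin (d 0) → ℝ)} {i j : Fin n} (h : IsomorphicIn G s i j) (ℓ : ℕ) :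
    θ.rep G s ℓ i = θ.rep G s ℓ j := by
  obtain ⟨σ, hs, rfl⟩ := h
  exact (θ.rep_comp_automorphism σ hs ℓ i).symm

theorem norm_neighborMean_sub_le {n m : ℕ} (G : SimpleGraph (Fin n))
    {f f' : Fin n → (Fin m → ℝ)} {c : ℝ} (hc : 0 ≤ c) (h : ∀ j, ‖f j - f' j‖ ≤ c) (i : Fin n) :
    ‖neighborMean G f i - neighborMean G f' i‖ ≤ c := by
  classical
  unfold neighborMean
  rw [← smul_sub, ← Finset.sum_sub_distrib, norm_smul, norm_inv, Real.norm_natCast]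
  -- Only nonnegativity of the degree is needed, so an empty neighbourhood is covered.
  refine inv_mul_le_of_le_mul₀ (Nat.cast_nonneg _) hc ?_
  refine (norm_sum_le_of_le _ fun j _ => h j).trans ?_
  rw [Finset.sum_const, nsmul_eq_mul]

end Predictor

/-- Stability of a quotient. The difference is `((A - m a) - (a / δ) (D - m δ)) / D`; the numerator
is at most `4 κ m r`, and `2 r ≤ ε / 2` forces `D ≥ m ε / 2`, whence the factor 8. -/
theorem abs_inv_mul_sub_div_le {A D a δ m κ r ε : ℝ} (hm : 0 < m) (hε : 0 < ε) (hδ : ε ≤ δ)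
    (hκ : 0 ≤ κ) (hA : |A - m * a| ≤ m * (2 * κ * r)) (hD : |D - m * δ| ≤ m * (2 * r))
    (ha : |a| ≤ κ * δ) (hr : 2 * r ≤ ε / 2) : |D⁻¹ * A - a / δ| ≤ 8 * κ * r / ε := by
  have hδ0 : 0 < δ := hε.trans_le hδ
  have hDlow : m * (ε / 2) ≤ D := by
    have h1 := (abs_le.1 hD).1
    have h2 : m * (2 * r) ≤ m * (ε / 2) := by gcongr
    have h3 : m * ε ≤ m * δ := by gcongr
    linarith
  have hD0 : 0 < D := lt_of_lt_of_le (by positivity) hDlow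
  have hq : |a / δ| ≤ κ := by
    rw [abs_div, abs_of_pos hδ0, div_le_iff₀ hδ0]; exact ha
  have heq : D⁻¹ * A - a / δ = ((A - m * a) - a / δ * (D - m * δ)) / D := by
    field_simp; ring
  have hnum : |(A - m * a) - a / δ * (D - m * δ)| ≤ 4 * κ * (m * r) := by
    calc _ ≤ |A - m * a| + |a / δ * (D - m * δ)| := abs_sub _ _
      _ ≤ m * (2 * κ * r) + κ * (m * (2 * r)) := by
          rw [abs_mul]; gcongr
      _ = _ := by ring
  have hr0 : 0 ≤ m * r := by linarith [(abs_nonneg _).trans hD]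
  rw [heq, abs_div, abs_of_pos hD0]
  calc _ ≤ 4 * κ * (m * r) / (m * (ε / 2)) := by gcongr
    _ = _ := by field_simp; ring

/-! ### Neighbour sums and the union bound over entities. -/

namespace GraphModel

variable {χ : Type*} [MeasurableSpace χ] {K : Type*} {F : ℕ}

open Classical in
theorem sum_neighbors_eq (P : GraphModel χ K F) {m : ℕ} (S : Sample χ (m + 1)) (i : Fin (m + 1))
    {E : Type*} [AddCommMonoid E] (f : Fin (m + 1) → E) :
    ∑ j ∈ Finset.univ.filter ((P.graph S).Adj i), f j
      = ∑ j : Fin m, if (S.2 s(i, i.succAbove j) : ℝ) < P.W (S.1 i) (S.1 (i.succAbove j))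
          then f (i.succAbove j) else 0 := by
  rw [Finset.sum_filter, Fin.sum_univ_succAbove _ i, if_neg ((P.graph S).loopless.irrefl i),
    zero_add]
  refine Finset.sum_congr rfl fun j _ => ?_
  have h : (P.graph S).Adj i (i.succAbove j) ↔
      (S.2 s(i, i.succAbove j) : ℝ) < P.W (S.1 i) (S.1 (i.succAbove j)) :=
    ⟨fun h => h.2, fun h => ⟨(i.succAbove_ne j).symm, h⟩⟩
  simp only [h]

/-- The deviation of the sum of `φ (X_i, X_j)` over the neighbours `j` of `i` from `n - 1` times
its mean, given `X_i`. -/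
noncomputable def edgeDeviation (P : GraphModel χ K F) {m : ℕ} (φ : χ × χ → ℝ) (i : Fin (m + 1))
    (S : Sample χ (m + 1)) : ℝ :=
  ∑ j : Fin m, ((if (S.2 s(i, i.succAbove j) : ℝ) < P.W (S.1 i) (S.1 (i.succAbove j))
      then φ (S.1 i, S.1 (i.succAbove j)) else 0) - ∫ y, P.W (S.1 i) y * φ (S.1 i, y) ∂P.μ)

open Classical in
theorem edgeDeviation_eq (P : GraphModel χ K F) {m : ℕ} (φ : χ × χ → ℝ) (i : Fin (m + 1))
    (S : Sample χ (m + 1)) :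
    P.edgeDeviation φ i S = ∑ j ∈ Finset.univ.filter ((P.graph S).Adj i), φ (S.1 i, S.1 j)
      - m * ∫ y, P.W (S.1 i) y * φ (S.1 i, y) ∂P.μ := by
  rw [P.sum_neighbors_eq S i fun j => φ (S.1 i, S.1 j), edgeDeviation, Finset.sum_sub_distrib]
  simp

theorem fixedLaw_exists_edgeDeviation_le (P : GraphModel χ K F) {m : ℕ}
    {φ : χ × χ → ℝ} (hφ : Measurable φ) {b : ℝ} (hb0 : 0 ≤ b)
    (hb : ∀ᵐ x ∂P.μ, ∀ᵐ y ∂P.μ, |φ (x, y)| ≤ b) {t : ℝ} (ht : 0 ≤ t) :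
    P.fixedLaw (m + 1) {S | ∃ i, t ≤ |P.edgeDeviation φ i S|}
      ≤ ENNReal.ofReal ((m + 1) * (2 * Real.exp (-t ^ 2 / (2 * (m * b ^ 2))))) := by
  calc P.fixedLaw (m + 1) {S | ∃ i, t ≤ |P.edgeDeviation φ i S|}
      = P.fixedLaw (m + 1) (⋃ i, {S | t ≤ |P.edgeDeviation φ i S|}) := by
        congr 1; ext S; simp
    _ ≤ ∑ i, P.fixedLaw (m + 1) {S | t ≤ |P.edgeDeviation φ i S|} := measure_iUnion_fintype_le _ _
    _ ≤ ∑ _ : Fin (m + 1), ENNReal.ofReal (2 * Real.exp (-t ^ 2 / (2 * (m * b ^ 2)))) :=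
        Finset.sum_le_sum fun i _ => P.fixedLaw_edge_sum_deviation_le i hφ hb0 hb ht
    _ = _ := by
        rw [Finset.sum_const, Finset.card_univ, Fintype.card_fin, nsmul_eq_mul,
          ENNReal.ofReal_mul (p := (m : ℝ) + 1) (by positivity), ← Nat.cast_succ,
          ENNReal.ofReal_natCast]

theorem fixedLaw_not_forall_eq_zero (P : GraphModel χ K F) {n : ℕ} {p : χ → Prop}
    (hp : ∀ᵐ x ∂P.μ, p x) : P.fixedLaw n {S | ¬ ∀ i, p (S.1 i)} = 0 := by
  have h : ∀ᵐ X ∂(Measure.pi fun _ : Fin n => P.μ), ∀ i, p (X i) := ae_all_iff.2 fun i =>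
    (measurePreserving_eval (fun _ : Fin n => P.μ) i).quasiMeasurePreserving.ae hp
  exact (Measure.quasiMeasurePreserving_fst (ν := Measure.pi fun _ : Sym2 (Fin n) =>
    (volume : Measure unitInterval))).ae h

end GraphModel

/-! ### Propagation of the error through the layers. -/

namespace Predictor

variable {χ : Type*} [MeasurableSpace χ] {K Q : Type*} {d : ℕ → ℕ}

/-- The coordinate `k` of the message of layer `ℓ + 1` between entities with continuous
representations. -/
noncomputable def contMsg (θ : Predictor Q d) (P : GraphModel χ K (d 0)) (ℓ : ℕ) (k : Fin (d (ℓ + 1)))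
    (w : χ × χ) : ℝ :=
  θ.msg ℓ (θ.contRep P ℓ w.1, θ.contRep P ℓ w.2) k

theorem norm_neighborMean_sub_integral_le {θ : Predictor Q d} {L : ℕ} {B : LayerBounds}
    (hθ : θ.HasLayerBounds L B) {P : GraphModel χ K (d 0)} {ε : ℝ} (hε : 0 < ε)
    (hdeg : ∀ x, ε ≤ P.degree x) {g : ℝ} (hg : ∀ᵐ x ∂P.μ, ‖P.signal x‖ ≤ g) {m : ℕ} (hm : 0 < m)
    {S : Sample χ (m + 1)} {r : ℝ} (hr0 : 0 ≤ r) (hr : 2 * r ≤ ε / 2) (i : Fin (m + 1))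
    (hS : ‖P.signal (S.1 i)‖ ≤ g) {ℓ : ℕ} (hℓ : ℓ < L) {κ : ℝ}
    (hκ : B.msgBound ℓ (B.repBound g ℓ) ≤ κ)
    (hD : |P.edgeDeviation (fun _ => 1) i S| ≤ m * (2 * r))
    (hA : ∀ k, |P.edgeDeviation (θ.contMsg P ℓ k) i S| ≤ m * (2 * κ * r)) :
    ‖neighborMean (P.graph S)
        (fun j => θ.msg ℓ (θ.contRep P ℓ (S.1 i), θ.contRep P ℓ (S.1 j))) i
      - ∫ y, (P.W (S.1 i) y / P.degree (S.1 i)) •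
          θ.msg ℓ (θ.contRep P ℓ (S.1 i), θ.contRep P ℓ y) ∂P.μ‖ ≤ 8 * κ * r / ε := by
  classical
  obtain ⟨hmsg, -, hmb, -⟩ := hθ ℓ hℓ
  have hdeg0 : ∀ x, 0 < P.degree x := fun x => hε.trans_le (hdeg x)
  set x := S.1 i with hx
  have hfx : ‖θ.contRep P ℓ x‖ ≤ B.repBound g ℓ := norm_contRep_le hθ hdeg0 hg hℓ.le hS
  have hmsgb : ∀ᵐ y ∂P.μ, ‖θ.msg ℓ (θ.contRep P ℓ x, θ.contRep P ℓ y)‖ ≤ κ :=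
    hg.mono fun y hy => (norm_le_of_lipschitzWith hmsg hmb
      (norm_prod_le_iff.2 ⟨hfx, norm_contRep_le hθ hdeg0 hg hℓ.le hy⟩)).trans hκ
  have hκ0 : 0 ≤ κ :=
    (B.msgBound_nonneg ℓ ((norm_nonneg _).trans hfx)).trans hκ
  have hcm := measurable_contRep hθ P hℓ.le
  have hmm : Measurable fun y => θ.msg ℓ (θ.contRep P ℓ x, θ.contRep P ℓ y) :=
    hmsg.continuous.measurable.comp (measurable_const.prodMk hcm)
  have hint := P.integrable_W_div_degree_smul x hmm hmsgb
  have hbound := P.norm_integral_W_div_degree_smul_le (hdeg0 x) hmsgb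
  refine (pi_norm_le_iff_of_nonneg (by positivity)).2 fun k => ?_
  have hk : (∫ y, (P.W x y / P.degree x) •
      θ.msg ℓ (θ.contRep P ℓ x, θ.contRep P ℓ y) ∂P.μ) k
      = (∫ y, P.W x y * θ.contMsg P ℓ k (x, y) ∂P.μ) / P.degree x := by
    rw [eval_integral (fun k => hint.eval k), ← integral_div]
    refine integral_congr_ae (Filter.Eventually.of_forall fun y => ?_)
    simp only [Pi.smul_apply, smul_eq_mul, contMsg]
    ring
  -- Writing the degree as a sum of ones makes it the case `φ = 1` of the edge sums.
  have hnm : neighborMean (P.graph S)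
        (fun j => θ.msg ℓ (θ.contRep P ℓ x, θ.contRep P ℓ (S.1 j))) i k
      = (∑ j ∈ Finset.univ.filter ((P.graph S).Adj i), (1 : ℝ))⁻¹
        * ∑ j ∈ Finset.univ.filter ((P.graph S).Adj i), θ.contMsg P ℓ k (x, S.1 j) := by
    unfold neighborMean
    rw [Pi.smul_apply, Finset.sum_apply, smul_eq_mul, Finset.sum_const, nsmul_eq_mul, mul_one]
    rfl
  rw [Pi.sub_apply, hk, hnm, Real.norm_eq_abs]
  refine abs_inv_mul_sub_div_le (m := m) (by exact_mod_cast hm) hε (hdeg x) hκ0 ?_ ?_ ?_ hr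
  · rw [← P.edgeDeviation_eq]; exact hA k
  · rw [P.edgeDeviation_eq] at hD
    simp only [mul_one] at hD
    exact hD
  · have h := (norm_le_pi_norm _ k).trans hbound
    rw [hk, norm_div, Real.norm_eq_abs, Real.norm_of_nonneg (hdeg0 x).le,
      div_le_iff₀ (hdeg0 x)] at h
    exact h

/-- If all neighbourhood sums are close to their means, the discrete representations are close to
the continuous ones. -/
theorem norm_rep_sub_contRep_le {θ : Predictor Q d} {L : ℕ} {B : LayerBounds}
    (hθ : θ.HasLayerBounds L B) {P : GraphModel χ K (d 0)} {ε : ℝ} (hε : 0 < ε)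
    (hdeg : ∀ x, ε ≤ P.degree x) {g : ℝ} (hg0 : 0 ≤ g) (hg : ∀ᵐ x ∂P.μ, ‖P.signal x‖ ≤ g)
    {m : ℕ} (hm : 0 < m) {S : Sample χ (m + 1)} {r : ℝ} (hr0 : 0 ≤ r) (hr : 2 * r ≤ ε / 2)
    (hS : ∀ i, ‖P.signal (S.1 i)‖ ≤ g)
    (hD : ∀ ℓ < L, ∀ i, |P.edgeDeviation (fun _ => 1) i S| ≤ m * (2 * r))
    (hA : ∀ ℓ < L, ∀ k i, |P.edgeDeviation (θ.contMsg P ℓ k) i S|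
      ≤ m * (2 * (B.msgBound ℓ (B.repBound g ℓ) + 1) * r))
    {ℓ : ℕ} (hℓ : ℓ ≤ L) (i : Fin (m + 1)) :
    ‖θ.rep (P.graph S) (fun i => P.signal (S.1 i)) ℓ i - θ.contRep P ℓ (S.1 i)‖
      ≤ B.errBound g ℓ / ε * r := by
  induction ℓ generalizing i with
  | zero => simp [rep, contRep, LayerBounds.errBound]
  | succ ℓ ih =>
    have ih := ih (by omega)
    have hℓ' : ℓ < L := by omega
    obtain ⟨hmsg, hupd, -, -⟩ := hθ ℓ hℓ'
    set e := B.errBound g ℓ / ε * r with he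
    have he0 : 0 ≤ e := (norm_nonneg _).trans (ih i)
    set κ := B.msgBound ℓ (B.repBound g ℓ) + 1 with hκ
    have hκ0 : 0 ≤ κ := by
      have := B.msgBound_nonneg ℓ (B.repBound_nonneg hg0 ℓ)
      linarith
    have hconc := norm_neighborMean_sub_integral_le hθ hε hdeg hg hm hr0 hr i (hS i) hℓ'
      (κ := κ) (by linarith) (hD ℓ hℓ' i) (fun k => hA ℓ hℓ' k i)
    have hmean := norm_neighborMean_sub_le (P.graph S)
      (f := fun j => θ.msg ℓ (θ.rep (P.graph S) (fun i => P.signal (S.1 i)) ℓ i,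
        θ.rep (P.graph S) (fun i => P.signal (S.1 i)) ℓ j))
      (f' := fun j => θ.msg ℓ (θ.contRep P ℓ (S.1 i), θ.contRep P ℓ (S.1 j)))
      (c := B.msgLip ℓ * e) (by positivity) (fun j => by
        refine (hmsg.norm_sub_le _ _).trans ?_
        gcongr
        exact norm_prod_le_iff.2 ⟨ih i, ih j⟩) i
    simp only [rep, contRep]
    refine (hupd.norm_sub_le _ _).trans ?_
    -- The sum of the error in the representation and the error in the aggregated message dominates
    -- their maximum, the norm of the pair.
    have hgoal : B.errBound g (ℓ + 1) / ε * r
        = B.updLip ℓ * (e + (B.msgLip ℓ * e + 8 * κ * r / ε)) := by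
      rw [LayerBounds.errBound, he]
      ring
    rw [hgoal]
    gcongr
    refine norm_prod_le_iff.2 ⟨(ih i).trans (le_add_of_nonneg_right (by positivity)), ?_⟩
    exact ((norm_sub_le_norm_sub_add_norm_sub _ _ _).trans (add_le_add hmean hconc)).trans
      (le_add_of_nonneg_left he0)

end Predictor

/-- The consequences of the lower bound on the number of entities. -/
theorem deviation_scale_bounds {ε p : ℝ} (hε : 0 < ε) (hε1 : ε ≤ 1) (hp0 : 0 < p) (hp1 : p < 1)
    {m : ℕ} (h : 4 * √2 / ε ≤ √((m + 1 : ℕ) : ℝ) / √(Real.log (2 * (m + 1 : ℕ) / p))) :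
    0 < m ∧ 0 < √(Real.log (2 * (m + 1 : ℕ) / p) / (m + 1 : ℕ)) ∧
      2 * √(Real.log (2 * (m + 1 : ℕ) / p) / (m + 1 : ℕ)) ≤ ε / 2 ∧
      ∀ κ : ℝ, 0 < κ → ((m : ℝ) + 1) * (2 * Real.exp
        (-(m * (2 * κ * √(Real.log (2 * (m + 1 : ℕ) / p) / (m + 1 : ℕ)))) ^ 2
          / (2 * (m * κ ^ 2)))) ≤ p := by
  have hn1 : (1 : ℝ) ≤ ((m + 1 : ℕ) : ℝ) := by exact_mod_cast Nat.succ_le_succ (Nat.zero_le m)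
  set n : ℝ := ((m + 1 : ℕ) : ℝ) with hn
  have hn0 : 0 < n := by linarith
  have harg : 2 ≤ 2 * n / p := by
    rw [le_div_iff₀ hp0]; nlinarith
  have hlog : 0 < Real.log (2 * n / p) := Real.log_pos (by linarith)
  have hlog2 : Real.log 2 ≤ Real.log (2 * n / p) := Real.log_le_log (by norm_num) harg
  set l := Real.log (2 * n / p) with hl
  have hr0 : 0 < √(l / n) := Real.sqrt_pos.2 (by positivity)
  have hrsq : √(l / n) ^ 2 = l / n := Real.sq_sqrt (by positivity)
  have hinv : √n / √l = (√(l / n))⁻¹ := by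
    rw [Real.sqrt_div hlog.le, inv_div]
  rw [hinv] at h
  set r := √(l / n) with hr
  have hs2 : (1 : ℝ) ≤ √2 := Real.one_le_sqrt.2 (by norm_num)
  have hrε : 4 * r ≤ ε := by
    rw [div_le_iff₀ hε, inv_mul_eq_div, le_div_iff₀ hr0] at h
    nlinarith
  -- A single entity is impossible: then `r ^ 2 = l ≥ log 2`, while `4 r ≤ ε ≤ 1`.
  have hm : 0 < m := by
    rcases Nat.eq_zero_or_pos m with rfl | hm
    · exfalso
      have hn' : n = 1 := by simp [hn]
      rw [hn', div_one] at hrsq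
      have := Real.log_two_gt_d9
      nlinarith
    · exact hm
  refine ⟨hm, hr0, by linarith, fun κ hκ => ?_⟩
  have hm1 : (1 : ℝ) ≤ m := by exact_mod_cast hm
  have hnm : n = m + 1 := by simp [hn]
  -- The exponent equals `-2 m l / n`, and `n = m + 1 ≤ 2 m`. Since `exp (-l) = p / (2 n)`, the
  -- union over `n` entities and two tails costs exactly `p`.
  have hexp : -(m * (2 * κ * r)) ^ 2 / (2 * (m * κ ^ 2)) ≤ -l := by
    have : -(m * (2 * κ * r)) ^ 2 / (2 * (m * κ ^ 2)) = -(2 * m * r ^ 2) := by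
      field_simp
    rw [this, hrsq, neg_le_neg_iff, mul_div_assoc', le_div_iff₀ hn0]
    nlinarith
  calc _ ≤ ((m : ℝ) + 1) * (2 * Real.exp (-l)) := by gcongr
    _ = p := by
        rw [Real.exp_neg, hl, Real.exp_log (by linarith), ← hnm]
        field_simp

/-- The union bound costs `(d (ℓ + 1) + 1) * p` per layer; the factor 2 on the right is slack. -/
theorem sum_range_layer_bound_le (d : ℕ → ℕ) (L : ℕ) {p : ℝ} (hp : 0 ≤ p) :
    ∑ ℓ ∈ Finset.range L, ((d (ℓ + 1) : ℝ) + 1) * p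
      ≤ ∑ ℓ ∈ Finset.Icc 1 L, 2 * ((d ℓ : ℝ) + 1) * p := by
  rw [Finset.range_eq_Ico,
    Finset.sum_Ico_add' (fun ℓ => ((d ℓ : ℝ) + 1) * p) 0 L 1, zero_add]
  refine Finset.sum_le_sum fun ℓ _ => ?_
  have : 0 ≤ ((d ℓ : ℝ) + 1) * p := by positivity
  linarith

/-! ### The high-probability estimate at fixed size, and stability of thresholded scores. -/

namespace Predictor

variable {χ : Type*} [MeasurableSpace χ] {K Q : Type*} {d : ℕ → ℕ}

/-- At a fixed number of entities, the discrete representations are close to the continuous ones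
with high probability. -/
theorem fixedLaw_not_norm_rep_sub_contRep_le {θ : Predictor Q d} {L : ℕ} {B : LayerBounds}
    (hθ : θ.HasLayerBounds L B) {P : GraphModel χ K (d 0)} {ε : ℝ} (hε : 0 < ε)
    (hdeg : ∀ x, ε ≤ P.degree x) {p : ℝ} (hp0 : 0 < p) (hp1 : p < 1) {n : ℕ} (hn : 0 < n)
    (h : 4 * √2 / ε ≤ √(n : ℝ) / √(Real.log (2 * n / p))) :
    P.fixedLaw n {S | ¬ ∀ i,
      ‖θ.rep (P.graph S) (fun i => P.signal (S.1 i)) L i - θ.contRep P L (S.1 i)‖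
        ≤ B.errBound P.signalNorm L / ε * √(Real.log (2 * n / p) / n)}
      ≤ ENNReal.ofReal (∑ ℓ ∈ Finset.Icc 1 L, 2 * ((d ℓ : ℝ) + 1) * p) := by
  obtain ⟨m, rfl⟩ := Nat.exists_eq_add_of_le' hn
  obtain ⟨x₀⟩ : Nonempty χ := P.μ.nonempty_of_neZero
  have hε1 : ε ≤ 1 := (hdeg x₀).trans (P.degree_le_one x₀)
  obtain ⟨hm, hr0, hr, htail⟩ := deviation_scale_bounds hε hε1 hp0 hp1 h
  set r := √(Real.log (2 * (m + 1 : ℕ) / p) / (m + 1 : ℕ)) with hrdef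
  set g := P.signalNorm with hgdef
  have hg0 : 0 ≤ g := P.signalNorm_nonneg
  have hg : ∀ᵐ x ∂P.μ, ‖P.signal x‖ ≤ g := P.norm_signal_le_signalNorm
  have hdeg0 : ∀ x, 0 < P.degree x := fun x => hε.trans_le (hdeg x)
  -- The summand 1 keeps `κ` positive: it is cancelled in the exponent, and at `κ = 0` the deviation
  -- event would be the whole space.
  set κ : ℕ → ℝ := fun ℓ => B.msgBound ℓ (B.repBound g ℓ) + 1 with hκ
  have hκ0 : ∀ ℓ, 0 < κ ℓ := fun ℓ => by
    have := B.msgBound_nonneg ℓ (B.repBound_nonneg hg0 ℓ)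
    simp only [hκ]; linarith
  set bad₀ : Set (Sample χ (m + 1)) := {S | ¬ ∀ i, ‖P.signal (S.1 i)‖ ≤ g}
  set badD : Set (Sample χ (m + 1)) :=
    {S | ∃ i, m * (2 * 1 * r) ≤ |P.edgeDeviation (fun _ => 1) i S|} with hbadD
  set badA : ∀ ℓ, Fin (d (ℓ + 1)) → Set (Sample χ (m + 1)) := fun ℓ k =>
    {S | ∃ i, m * (2 * κ ℓ * r) ≤ |P.edgeDeviation (θ.contMsg P ℓ k) i S|} with hbadA
  have h₀ : P.fixedLaw (m + 1) bad₀ = 0 := P.fixedLaw_not_forall_eq_zero hg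
  have hD : P.fixedLaw (m + 1) badD ≤ ENNReal.ofReal p :=
    (P.fixedLaw_exists_edgeDeviation_le (φ := fun _ => 1) measurable_const zero_le_one
      (by simp) (by positivity)).trans (ENNReal.ofReal_le_ofReal (htail 1 one_pos))
  have hA : ∀ ℓ < L, ∀ k, P.fixedLaw (m + 1) (badA ℓ k) ≤ ENNReal.ofReal p := by
    intro ℓ hℓ k
    obtain ⟨hmsg, -, hmb, -⟩ := hθ ℓ hℓ
    have hcm := measurable_contRep hθ P hℓ.le
    have hφ : Measurable (θ.contMsg P ℓ k) :=
      (measurable_pi_apply k).comp (hmsg.continuous.measurable.comp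
        ((hcm.comp measurable_fst).prodMk (hcm.comp measurable_snd)))
    refine (P.fixedLaw_exists_edgeDeviation_le hφ (hκ0 ℓ).le ?_
      (mul_nonneg (Nat.cast_nonneg m) (mul_nonneg (by have := hκ0 ℓ; positivity) hr0.le))).trans
      (ENNReal.ofReal_le_ofReal (htail (κ ℓ) (hκ0 ℓ)))
    filter_upwards [hg] with x hx
    filter_upwards [hg] with y hy
    have h1 : ‖θ.msg ℓ (θ.contRep P ℓ x, θ.contRep P ℓ y)‖ ≤ B.msgBound ℓ (B.repBound g ℓ) :=
      norm_le_of_lipschitzWith hmsg hmb (norm_prod_le_iff.2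
        ⟨norm_contRep_le hθ hdeg0 hg hℓ.le hx, norm_contRep_le hθ hdeg0 hg hℓ.le hy⟩)
    refine ((norm_le_pi_norm _ k).trans h1).trans ?_
    simp only [hκ]; linarith
  have hsub : {S | ¬ ∀ i,
      ‖θ.rep (P.graph S) (fun i => P.signal (S.1 i)) L i - θ.contRep P L (S.1 i)‖
        ≤ B.errBound g L / ε * r} ⊆
      -- `badD` is repeated in every layer to match the layerwise sum; for `L = 0` it disappears, as
      -- does the allowed failure probability.
      bad₀ ∪ ⋃ ℓ ∈ Finset.range L, (badD ∪ ⋃ k, badA ℓ k) := by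
    intro S hS
    by_contra hcon
    simp only [Set.mem_union, Set.mem_iUnion, not_or, not_exists, Finset.mem_range] at hcon
    obtain ⟨hc₀, hc⟩ := hcon
    refine hS fun i => norm_rep_sub_contRep_le hθ hε hdeg hg0 hg hm hr0.le hr
      (not_not.1 hc₀) (fun ℓ hℓ i => ?_) (fun ℓ hℓ k i => ?_) le_rfl i
    · have := (hc ℓ hℓ).1
      by_contra hlt
      exact this ⟨i, by rw [mul_one]; exact (not_le.1 hlt).le⟩
    · have := (hc ℓ hℓ).2 k
      by_contra hlt
      exact this ⟨i, (not_le.1 hlt).le⟩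
  calc _ ≤ P.fixedLaw (m + 1) (bad₀ ∪ ⋃ ℓ ∈ Finset.range L, (badD ∪ ⋃ k, badA ℓ k)) :=
        measure_mono hsub
    _ ≤ P.fixedLaw (m + 1) bad₀
        + P.fixedLaw (m + 1) (⋃ ℓ ∈ Finset.range L, (badD ∪ ⋃ k, badA ℓ k)) :=
        measure_union_le _ _
    _ ≤ 0 + ∑ ℓ ∈ Finset.range L, P.fixedLaw (m + 1) (badD ∪ ⋃ k, badA ℓ k) :=
        add_le_add h₀.le (measure_biUnion_finset_le _ _)
    _ ≤ ∑ ℓ ∈ Finset.range L, ENNReal.ofReal (((d (ℓ + 1) : ℝ) + 1) * p) := by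
        rw [zero_add]
        refine Finset.sum_le_sum fun ℓ hℓ => ?_
        calc _ ≤ P.fixedLaw (m + 1) badD + ∑ k, P.fixedLaw (m + 1) (badA ℓ k) :=
              (measure_union_le _ _).trans (by gcongr; exact measure_iUnion_fintype_le _ _)
          _ ≤ ENNReal.ofReal p + ∑ _k : Fin (d (ℓ + 1)), ENNReal.ofReal p :=
              add_le_add hD (Finset.sum_le_sum fun k _ => hA ℓ (Finset.mem_range.1 hℓ) k)
          _ = _ := by
              rw [Finset.sum_const, Finset.card_univ, Fintype.card_fin, nsmul_eq_mul, add_mul,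
                ENNReal.ofReal_add (by positivity) (by positivity), one_mul,
                ENNReal.ofReal_mul (by positivity), ENNReal.ofReal_natCast, add_comm]
    _ = ENNReal.ofReal (∑ ℓ ∈ Finset.range L, ((d (ℓ + 1) : ℝ) + 1) * p) :=
        (ENNReal.ofReal_sum_of_nonneg fun ℓ _ => by positivity).symm
    _ ≤ _ := ENNReal.ofReal_le_ofReal (sum_range_layer_bound_le d L hp0.le)

theorem score_same_side {θ : Predictor Q d} {L : ℕ} {ρ : ℝ≥0} {q : Q}
    (hρ : LipschitzWith ρ (θ.readout L q)) {P : GraphModel χ K (d 0)} (S : Σ n : ℕ, Sample χ n)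
    (u v v' : Fin S.1) {τ ε : ℝ} (hne : θ.score L (P.observe S) q u v ≠ τ)
    (hε : ρ * (2 * ε) ≤ |θ.score L (P.observe S) q u v - τ|)
    (hrep : ∀ i, ‖θ.rep (P.graph S.2) (fun i => P.signal (S.2.1 i)) L i
      - θ.contRep P L (S.2.1 i)‖ < ε)
    (hiso : P.Isomorphic (S.2.1 v) (S.2.1 v') ∨
      IsomorphicIn (P.graph S.2) (fun i => P.signal (S.2.1 i)) v v' ∨
      θ.contRep P L (S.2.1 v) = θ.contRep P L (S.2.1 v')) :
    (τ < θ.score L (P.observe S) q u v ∧ τ < θ.score L (P.observe S) q u v') ∨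
      (θ.score L (P.observe S) q u v < τ ∧ θ.score L (P.observe S) q u v' < τ) := by
  set h := θ.rep (P.graph S.2) (fun i => P.signal (S.2.1 i)) L with hdef
  have hscore : |θ.score L (P.observe S) q u v' - θ.score L (P.observe S) q u v|
      ≤ ρ * ‖h v' - h v‖ := by
    have h1 := hρ.norm_sub_le (h u, h v') (h u, h v)
    rw [Prod.mk_sub_mk, sub_self, Prod.norm_mk, norm_zero, max_eq_right (norm_nonneg _)] at h1
    exact h1
  have hpos : 0 < |θ.score L (P.observe S) q u v - τ| := abs_pos.2 (sub_ne_zero.2 hne)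
  have hcont : θ.contRep P L (S.2.1 v) = θ.contRep P L (S.2.1 v') → ‖h v' - h v‖ < 2 * ε := by
    intro hc
    calc ‖h v' - h v‖
        = ‖(h v' - θ.contRep P L (S.2.1 v')) - (h v - θ.contRep P L (S.2.1 v))‖ := by
          rw [hc]; congr 1; abel
      _ ≤ ‖h v' - θ.contRep P L (S.2.1 v')‖ + ‖h v - θ.contRep P L (S.2.1 v)‖ :=
          norm_sub_le _ _
      _ < 2 * ε := by linarith [hrep v, hrep v']
  have hclose : ‖h v' - h v‖ < 2 * ε := by
    rcases hiso with hi | hi | hi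
    · exact hcont (θ.contRep_eq_of_isomorphic hi L)
    · rw [hdef, θ.rep_eq_of_isomorphicIn hi L, sub_self, norm_zero]
      linarith [(norm_nonneg _).trans_lt (hrep v)]
    · exact hcont hi
  have hlt : |θ.score L (P.observe S) q u v' - θ.score L (P.observe S) q u v|
      < |θ.score L (P.observe S) q u v - τ| := by
    -- For `ρ = 0` the two scores coincide, and strictness comes from `τ` not being attained instead
    -- of from `hclose`.
    rcases eq_or_lt_of_le ρ.coe_nonneg with h0 | h0
    · rw [← h0, zero_mul] at hscore
      exact hscore.trans_lt hpos
    · exact (hscore.trans_lt (mul_lt_mul_of_pos_left hclose h0)).trans_le hε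
  rw [abs_lt] at hlt
  rcases lt_or_gt_of_ne hne with hl | hg
  · rw [abs_of_neg (sub_neg.2 hl)] at hlt
    exact Or.inr ⟨hl, by linarith [hlt.2]⟩
  · rw [abs_of_pos (sub_pos.2 hg)] at hlt
    exact Or.inl ⟨hg, by linarith [hlt.1]⟩

end Predictor

/-! ### Mixing over the random number of entities. -/

namespace GraphModel

variable {χ : Type*} [MeasurableSpace χ] {K : Type*} {F : ℕ}

theorem law_apply (P : GraphModel χ K F) (N : PMF ℕ) {s : Set (Σ n : ℕ, Sample χ n)}
    (hs : MeasurableSet s) : P.law N s = ∑' n, N n * P.fixedLaw n (Sigma.mk n ⁻¹' s) := by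
  have hmk : ∀ n, Measurable (Sigma.mk n : Sample χ n → Σ n : ℕ, Sample χ n) := fun n =>
    measurable_iff_le_map.2 (iInf_le _ n)
  rw [law, Measure.sum_apply _ hs]
  congr 1
  funext n
  rw [Measure.smul_apply, Measure.map_apply (hmk n) hs, smul_eq_mul]

theorem measurableSet_sigma_iff {s : Set (Σ n : ℕ, Sample χ n)} :
    MeasurableSet s ↔ ∀ n, MeasurableSet (Sigma.mk n ⁻¹' s) :=
  MeasurableSpace.measurableSet_iInf

instance isProbabilityMeasure_law (P : GraphModel χ K F) (N : PMF ℕ) :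
    IsProbabilityMeasure (P.law N) :=
  ⟨by rw [P.law_apply N MeasurableSet.univ]; simp [N.tsum_coe]⟩

theorem ae_law_size_mem_support (P : GraphModel χ K F) (N : PMF ℕ) :
    ∀ᵐ S ∂(P.law N), S.1 ∈ N.support := by
  have hm : MeasurableSet {S : Σ n : ℕ, Sample χ n | ¬ S.1 ∈ N.support} :=
    measurableSet_sigma_iff.2 fun n =>
      MeasurableSet.const (n ∉ N.support)
  rw [ae_iff, P.law_apply N hm, ENNReal.tsum_eq_zero]
  intro n
  by_cases hn : n ∈ N.support
  · rw [show Sigma.mk n ⁻¹' {S : Σ n : ℕ, Sample χ n | ¬ S.1 ∈ N.support} = ∅ by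
      ext S; simpa using hn]
    simp
  · rw [N.apply_eq_zero_iff n |>.2 hn, zero_mul]

/-- Events of high probability at every possible number of entities contain a measurable event of
high probability. -/
theorem exists_measurableSet_le_law_real (P : GraphModel χ K F) (N : PMF ℕ)
    (E : ∀ n, Set (Sample χ n)) {δ : ℝ} (hδ : 0 ≤ δ)
    (hE : ∀ n ∈ N.support, P.fixedLaw n (E n)ᶜ ≤ ENNReal.ofReal δ) :
    ∃ good : Set (Σ n : ℕ, Sample χ n), MeasurableSet good ∧ 1 - δ ≤ (P.law N).real good ∧
      ∀ S ∈ good, S.1 ∈ N.support ∧ S.2 ∈ E S.1 := by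
  -- Measurable hulls of the failure events, taken size by size, avoid any measurability requirement
  -- on `E` and have the same measure.
  set bad : Set (Σ n : ℕ, Sample χ n) :=
    {S | ¬ (S.1 ∈ N.support) ∨ S.2 ∈ toMeasurable (P.fixedLaw S.1) (E S.1)ᶜ} with hbad
  have hm : MeasurableSet bad := measurableSet_sigma_iff.2 fun n =>
    (MeasurableSet.const (n ∉ N.support)).union
      (measurableSet_toMeasurable (P.fixedLaw n) (E n)ᶜ)
  refine ⟨badᶜ, hm.compl, ?_, fun S hS => ?_⟩
  · have hle : P.law N bad ≤ ENNReal.ofReal δ := by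
      rw [P.law_apply N hm]
      calc _ ≤ ∑' n, N n * ENNReal.ofReal δ := by
            refine ENNReal.tsum_le_tsum fun n => ?_
            by_cases hn : n ∈ N.support
            · gcongr
              rw [show Sigma.mk n ⁻¹' bad = toMeasurable (P.fixedLaw n) (E n)ᶜ by
                ext S; exact or_iff_right (not_not.2 hn), measure_toMeasurable]
              exact hE n hn
            · rw [(N.apply_eq_zero_iff n).2 hn, zero_mul, zero_mul]
        _ = ENNReal.ofReal δ := by rw [ENNReal.tsum_mul_right, N.tsum_coe, one_mul]
    rw [probReal_compl_eq_one_sub hm]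
    have := ENNReal.toReal_le_of_le_ofReal hδ hle
    rw [measureReal_def]
    linarith
  · have h := not_or.1 (show ¬ (¬ (S.1 ∈ N.support) ∨ _) from hS)
    refine ⟨not_not.1 h.1, ?_⟩
    by_contra hS'
    exact h.2 (subset_toMeasurable _ _ hS')

end GraphModel

end GraphExtrapolation

/-! ### Assembly of the theorem. -/

open GraphExtrapolation in
theorem theorem1 (L : ℕ) (B : LayerBounds) :
    ∃ C₁ C₂ : ℝ, 0 ≤ C₁ ∧ 0 ≤ C₂ ∧
      ∀ {χ K Q : Type*} [MeasurableSpace χ] (d : ℕ → ℕ) (P : GraphModel χ K (d 0))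
        (dmin : ℝ) (_ : 0 < dmin) (_ : ∀ x, dmin ≤ P.degree x)
        (trainSize testSize : PMF ℕ) (M : ℕ) (_ : IsGreatest trainSize.support M)
        (_ : ∀ n ∈ testSize.support, M < n)
        (train : SignalGraph (d 0) → Predictor Q d) (ρ : NNReal)
        (_ : ∀ G : SignalGraph (d 0), G.1 ≤ M →
          (train G).HasLayerBounds L B ∧ ∀ q, LipschitzWith ρ ((train G).readout L q))
        (p : ℝ) (_ : 0 < p) (_ : p < 1)
        (_ : ∀ n ∈ testSize.support,
          4 * √2 / dmin ≤ √(n : ℝ) / √(Real.log (2 * n / p))),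
        ∀ᵐ S₀ ∂(P.law trainSize), ∃ good : Set (Σ n : ℕ, Sample χ n),
          MeasurableSet good ∧
          1 - ∑ ℓ ∈ Finset.Icc 1 L, 2 * ((d ℓ : ℝ) + 1) * p ≤ (P.law testSize).real good ∧
          ∀ S ∈ good,
            (∀ v : Fin S.1,
              ‖(train (P.observe S₀)).rep (P.graph S.2) (fun i => P.signal (S.2.1 i)) L v
                  - (train (P.observe S₀)).contRep P L (S.2.1 v)‖
                ≤ (C₁ + C₂ * P.signalNorm) / dmin * √(Real.log (2 * S.1 / p) / S.1)) ∧
            ∀ (q : Q) (u v v' : Fin S.1) (τ : ℝ),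
              τ ∈ Set.Icc (0 : ℝ) 1 →
              (train (P.observe S₀)).score L (P.observe S) q u v ≠ τ →
              2 * ((C₁ + C₂ * P.signalNorm) / dmin)
                  / (|(train (P.observe S₀)).score L (P.observe S) q u v - τ| / ρ)
                ≤ √(S.1 : ℝ) / √(Real.log (2 * S.1 / p)) →
              (P.Isomorphic (S.2.1 v) (S.2.1 v') ∨
                IsomorphicIn (P.graph S.2) (fun i => P.signal (S.2.1 i)) v v' ∨
                (train (P.observe S₀)).contRep P L (S.2.1 v)
                  = (train (P.observe S₀)).contRep P L (S.2.1 v')) →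
              (τ < (train (P.observe S₀)).score L (P.observe S) q u v ∧
                τ < (train (P.observe S₀)).score L (P.observe S) q u v') ∨
              ((train (P.observe S₀)).score L (P.observe S) q u v < τ ∧
                (train (P.observe S₀)).score L (P.observe S) q u v' < τ) := by
  obtain ⟨a, b, ha, hb, hab⟩ := B.exists_errBound_eq L
  -- The extra 1 makes the error bound strict, so that equality in the size condition of the second
  -- claim still keeps the score off `τ`.
  refine ⟨a + 1, b, by positivity, hb, ?_⟩
  intro χ K Q _ d P dmin hdmin hdeg trainSize testSize M hM htest train ρ htrain p hp0 hp1 hsize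
  -- Almost every training graph has at most `M` entities, so its predictor obeys the bounds. From
  -- here on it is fixed, and only the test law matters.
  filter_upwards [P.ae_law_size_mem_support trainSize] with S₀ hS₀
  obtain ⟨hθ, hρ⟩ := htrain (P.observe S₀) (hM.2 hS₀)
  set θ := train (P.observe S₀)
  have hpos : ∀ n ∈ testSize.support, 0 < n := fun n hn => (Nat.zero_le M).trans_lt (htest n hn)
  have hg0 := P.signalNorm_nonneg
  have herr : B.errBound P.signalNorm L < a + 1 + b * P.signalNorm := by rw [hab]; linarith
  have hE := fun n (hn : n ∈ testSize.support) =>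
    Predictor.fixedLaw_not_norm_rep_sub_contRep_le hθ hdmin hdeg hp0 hp1 (hpos n hn) (hsize n hn)
  obtain ⟨good, hgood, hprob, hmem⟩ := P.exists_measurableSet_le_law_real testSize
    (fun n => {S : Sample χ n | ∀ i,
      ‖θ.rep (P.graph S) (fun i => P.signal (S.1 i)) L i - θ.contRep P L (S.1 i)‖
        ≤ B.errBound P.signalNorm L / dmin * √(Real.log (2 * n / p) / n)})
    (Finset.sum_nonneg fun ℓ _ => by positivity) hE
  refine ⟨good, hgood, hprob, fun S hS => ?_⟩
  obtain ⟨hSn, hrep⟩ := hmem S hS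
  have hn1 : (1 : ℝ) ≤ S.1 := by exact_mod_cast hpos S.1 hSn
  have hlog : 0 < Real.log (2 * S.1 / p) :=
    Real.log_pos (by rw [lt_div_iff₀ hp0]; linarith)
  have hr0 : 0 < √(Real.log (2 * S.1 / p) / S.1) := Real.sqrt_pos.2 (by positivity)
  have hlt : ∀ v : Fin S.1,
      ‖θ.rep (P.graph S.2) (fun i => P.signal (S.2.1 i)) L v - θ.contRep P L (S.2.1 v)‖
        < (a + 1 + b * P.signalNorm) / dmin * √(Real.log (2 * S.1 / p) / S.1) := by
    intro v
    refine (hrep v).trans_lt ?_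
    gcongr
  refine ⟨fun v => (hlt v).le, fun q u v v' τ _ hne hcond hiso => ?_⟩
  refine Predictor.score_same_side (hρ q) S u v v' hne ?_ hlt hiso
  have hgap : 0 < |θ.score L (P.observe S) q u v - τ| := abs_pos.2 (sub_ne_zero.2 hne)
  -- For `ρ = 0`, division by zero turns the left side of `hcond` into 0, so it carries no
  -- information; the required bound is then trivial.
  rcases eq_or_lt_of_le ρ.coe_nonneg with h0 | h0
  · rw [← h0, zero_mul]; exact hgap.le
  · rw [div_le_iff₀ (by positivity)] at hcond
    rw [Real.sqrt_div hlog.le]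
    have hl : 0 < √(Real.log (2 * S.1 / p)) := Real.sqrt_pos.2 hlog
    have hn : 0 < √(S.1 : ℝ) := Real.sqrt_pos.2 (by linarith)
    calc _ = (2 * ((a + 1 + b * P.signalNorm) / dmin))
          * (ρ * (√(Real.log (2 * S.1 / p)) / √(S.1 : ℝ))) := by ring
      _ ≤ (√(S.1 : ℝ) / √(Real.log (2 * S.1 / p))
            * (|θ.score L (P.observe S) q u v - τ| / ρ))
          * (ρ * (√(Real.log (2 * S.1 / p)) / √(S.1 : ℝ))) := by gcongr
      _ = _ := by field_simp
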